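/- Let $k$ be a field and let ${\tt fdVec}$ be the abelian category of finite-dimensional $k$-vector spaces. Target category. Let ${\tt V}$ be the category of graded lines over $k$: objects are pairs $(L,n)$ of a one-dimensional vector space $L$ and a degree $n\in\mathbb Z$, morphisms $(L,n)\to(M,m)$ exist only for $n=m$ and are then the linear maps $L\to M$; $(L,n)\otimes(M,m)=(L\otimes M,n+m)$, with the symmetry $x\otimes y\mapsto(-1)^{nm}\,y\otimes x$. Bicharades. Let ${\tt A}$ be an abelian category with chosen kernels and cokernels. For $S\xrightarrow{h}T\xrightarrow{g}Z$ in ${\tt A}$ let $h_Z:{\rm Ker}(gh)\to{\rm Ker}(g)$ and $g^S:{\rm Coker}(h)\to{\rm Coker}(gh)$ be the maps induced by $h$ and by $g$, and let $\rho:{\rm Coker}(h_Z)\xrightarrow{\cong}{\rm Ker}(g^S)$ be the isomorphism induced by the composite ${\rm Ker}(g)\hookrightarrow T\twoheadrightarrow{\rm Coker}(h)$; identify canonically ${\rm Ker}(h_Z)\cong{\rm Ker}(h)$ and ${\rm Coker}(g^S)\cong{\rm Coker}(g)$. A bicharade over ${\tt A}$ with values in a symmetric monoidal category is a functor $Ch$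 on the isomorphisms of ${\tt A}$ together with a morphism $$\chi_h:Ch(T)\otimes Ch({\rm Ker}\,h)\longrightarrow Ch({\rm Coker}\,h)\otimes Ch(S)$$ for each $h:S\to T$, such that (a) for all $h':S'\to T'$, $h'':S''\to T''$ and isomorphisms $s:S'\to S''$, $t:T'\to T''$ with $th'=h''s$, if $s_t:{\rm Ker}\,h'\to{\rm Ker}\,h''$ and $t_s:{\rm Coker}\,h'\to{\rm Coker}\,h''$ denote the induced isomorphisms, then $(Ch(t_s)\otimes Ch(s))\,\chi_{h'}=\chi_{h''}\,(Ch(t)\otimes Ch(s_t))$; (b) for all $S\xrightarrow{h}T\xrightarrow{g}Z$, with $F={\rm Ker}\,h$, $D={\rm Coker}\,h$, $Y={\rm Ker}\,g$, $H={\rm Coker}\,g$, $X={\rm Ker}(gh)$, $R={\rm Coker}(gh)$, $\mho={\rm Coker}(h_Z)$, $\Omega={\rm Ker}(g^S)$, the following two morphisms $Ch(Z)\otimes Ch(Y)\otimes Ch(F)\to Ch(H)\otimes Ch(D)\otimes Ch(S)$ are equal: the composite $(1\otimes\chi_h)(\chi_g\otimes1)$, and the composite $$Z\,Y\,F\xrightarrow{1\otimes\chi_{h_Z}}Z\,\mho\,X\xrightarrow{\rm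 symmetry}Z\,X\,\mho\xrightarrow{\chi_{gh}\otimes Ch(\rho)}R\,S\,\Omega\xrightarrow{\rm symmetry}R\,\Omega\,S\xrightarrow{\chi_{g^S}\otimes1}H\,D\,S,$$ where a string of objects stands for the tensor product of their values under $Ch$. Determinant. For a finite-dimensional $S$ let $\det S=\Lambda^{\dim S}S$, placed in degree $\dim S$; it is functorial for isomorphisms. A short exact sequence $0\to S''\xrightarrow{i}S\xrightarrow{\pi}S'\to0$ induces an isomorphism $\det S'\otimes\det S''\xrightarrow{\cong}\det S$, $$(\pi u_1\wedge\dots\wedge\pi u_p)\otimes(v_1\wedge\dots\wedge v_q)\longmapsto u_1\wedge\dots\wedge u_p\wedge iv_1\wedge\dots\wedge iv_q .$$ For $h:S\to T$ the short exact sequences $0\to{\rm Ker}\,h\to S\to{\rm Im}\,h\to0$ and $0\to{\rm Im}\,h\to T\to{\rm Coker}\,h\to0$ thus give isomorphisms $${}^\bullet h:\det({\rm Im}\,h)\otimes\det({\rm Ker}\,h)\cong\det S,\qquad h^\bullet:\det({\rm Coker}\,h)\otimes\det({\rm Im}\,h)\cong\det T,$$ and one defines the isomorphism $$\chi_h=(1\otimes{}^\bullet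 h)\circ(h^\bullet\otimes1)^{-1}:\det T\otimes\det({\rm Ker}\,h)\longrightarrow\det({\rm Coker}\,h)\otimes\det S .$$ Claim. The functor $\det$ together with the isomorphisms $\chi_h$ is a bicharade over ${\tt fdVec}$ with values in the category ${\tt V}$ of graded lines. -/

import Mathlib

open CategoryTheory CategoryTheory.Limits MonoidalCategory Module

universe v u

noncomputable section

/-! ## The kernel-cokernel structure of an abelian category -/

namespace KerCoker

variable {A : Type u} [Category.{v} A] [Abelian A] {S T Z : A} (h : S ⟶ T) (g : T ⟶ Z)

/-- The map `h_Z : Ker (g ∘ h) ⟶ Ker g` between the fibers induced by `h`. -/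
def fiberMap : kernel (h ≫ g) ⟶ kernel g :=
  kernel.map (h ≫ g) g h (𝟙 Z) (by simp)

/-- The map `g^S : Coker h ⟶ Coker (g ∘ h)` between the cofibers induced by `g`. -/
def cofiberMap : cokernel h ⟶ cokernel (h ≫ g) :=
  cokernel.map h (h ≫ g) (𝟙 S) g (by simp)

@[simp]
lemma fiberMap_ι : fiberMap h g ≫ kernel.ι g = kernel.ι (h ≫ g) ≫ h := by
  simp [fiberMap]

@[simp]
lemma fiberMap_ι_assoc {W : A} (f : T ⟶ W) :
    fiberMap h g ≫ kernel.ι g ≫ f = kernel.ι (h ≫ g) ≫ h ≫ f := by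
  rw [← Category.assoc, fiberMap_ι, Category.assoc]

@[simp]
lemma π_cofiberMap : cokernel.π h ≫ cofiberMap h g = g ≫ cokernel.π (h ≫ g) := by
  simp [cofiberMap]

@[simp]
lemma π_cofiberMap_assoc {W : A} (f : cokernel (h ≫ g) ⟶ W) :
    cokernel.π h ≫ cofiberMap h g ≫ f = g ≫ cokernel.π (h ≫ g) ≫ f := by
  rw [← Category.assoc, π_cofiberMap, Category.assoc]

/-- The canonical isomorphism `Ker (h_Z) ≅ Ker h` of subobjects of `S`. -/
def kerFiberMapIso : kernel (fiberMap h g) ≅ kernel h where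
  hom := kernel.lift h (kernel.ι (fiberMap h g) ≫ kernel.ι (h ≫ g)) (by
    rw [Category.assoc, ← fiberMap_ι, kernel.condition_assoc, zero_comp])
  inv := kernel.lift (fiberMap h g) (kernel.lift (h ≫ g) (kernel.ι h) (by simp)) (by
    rw [← cancel_mono (kernel.ι g)]; simp)
  hom_inv_id := by
    rw [← cancel_mono (kernel.ι (fiberMap h g)), ← cancel_mono (kernel.ι (h ≫ g))]; simp
  inv_hom_id := by
    rw [← cancel_mono (kernel.ι h)]; simp

/-- The canonical isomorphism `Coker (g^S) ≅ Coker g` of quotients of `Z`. -/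
def cokerCofiberMapIso : cokernel (cofiberMap h g) ≅ cokernel g where
  hom := cokernel.desc (cofiberMap h g) (cokernel.desc (h ≫ g) (cokernel.π g) (by simp)) (by
    rw [← cancel_epi (cokernel.π h)]; simp)
  inv := cokernel.desc g (cokernel.π (h ≫ g) ≫ cokernel.π (cofiberMap h g)) (by
    rw [← π_cofiberMap_assoc, cokernel.condition, comp_zero])
  hom_inv_id := by
    rw [← cancel_epi (cokernel.π (cofiberMap h g)), ← cancel_epi (cokernel.π (h ≫ g))]; simp
  inv_hom_id := by
    rw [← cancel_epi (cokernel.π g)]; simp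

/-- The canonical map `ρ : Coker (h_Z) ⟶ Ker (g^S)`, induced by the composition
`Ker g ⟶ T ⟶ Coker h`. -/
def rho : cokernel (fiberMap h g) ⟶ kernel (cofiberMap h g) :=
  cokernel.desc (fiberMap h g)
    (kernel.lift (cofiberMap h g) (kernel.ι g ≫ cokernel.π h) (by simp))
    (by rw [← cancel_mono (kernel.ι (cofiberMap h g))]; simp)

lemma π_rho_ι : cokernel.π (fiberMap h g) ≫ rho h g ≫ kernel.ι (cofiberMap h g) =
    kernel.ι g ≫ cokernel.π h := by
  simp [rho]

instance : IsIso (rho h g) := by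
  have hδ := kernelCokernelCompSequence.δ_fac h g
  have e1 := (kernelCokernelCompSequence.snakeInput h g).L₁'_exact.mono_cokernelDesc
  have e2 := (kernelCokernelCompSequence.snakeInput h g).L₂'_exact.epi_kernelLift
  have m1 : -cokernel.desc (fiberMap h g) (kernelCokernelCompSequence.δ h g)
      (kernelCokernelCompSequence.snakeInput h g).L₁'.zero =
      rho h g ≫ kernel.ι (cofiberMap h g) := by
    rw [← cancel_epi (cokernel.π (fiberMap h g)), π_rho_ι]
    simp [hδ]
  have m2 : -kernel.lift (cofiberMap h g) (kernelCokernelCompSequence.δ h g)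
      (kernelCokernelCompSequence.snakeInput h g).L₂'.zero =
      cokernel.π (fiberMap h g) ≫ rho h g := by
    rw [← cancel_mono (kernel.ι (cofiberMap h g)), Category.assoc, π_rho_ι]
    simp [hδ]
  have : Mono (rho h g ≫ kernel.ι (cofiberMap h g)) := by
    rw [← m1]
    exact @Preadditive.instMonoNegHom _ _ _ _ _ _ e1
  have : Epi (cokernel.π (fiberMap h g) ≫ rho h g) := by
    rw [← m2]
    exact @Preadditive.instEpiNegHom _ _ _ _ _ _ e2
  have : Mono (rho h g) := mono_of_mono _ (kernel.ι (cofiberMap h g))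
  have : Epi (rho h g) := epi_of_epi (cokernel.π (fiberMap h g)) _
  exact isIso_of_mono_of_epi _

/-- The canonical isomorphism `ρ : Coker (h_Z) ≅ Ker (g^S)`. -/
def rhoIso : cokernel (fiberMap h g) ≅ kernel (cofiberMap h g) := asIso (rho h g)

end KerCoker

/-! ## Bicharades -/

open KerCoker in
/-- A bicharade over the abelian category `A`, whose fibers and cofibers are the kernels and the
cokernels, with values in the symmetric monoidal category `V`: a functor `Ch` on the isomorphisms
of `A` together with operations `χ h : Ch(T) ⊗ Ch(Ker h) ⟶ Ch(Coker h) ⊗ Ch(S)`. -/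
structure IsBicharade {A : Type u} [Category.{v} A] [Abelian A]
    {V : Type*} [Category* V] [MonoidalCategory V] [SymmetricCategory V]
    (Ch : Core A ⥤ V)
    (χ : ∀ {S T : A} (h : S ⟶ T),
      Ch.obj ⟨T⟩ ⊗ Ch.obj ⟨kernel h⟩ ⟶ Ch.obj ⟨cokernel h⟩ ⊗ Ch.obj ⟨S⟩) : Prop where
  /-- Compatibility with isomorphisms of arrows. -/
  naturality : ∀ {S' T' S'' T'' : A} (h' : S' ⟶ T') (h'' : S'' ⟶ T'')
    (s : S' ≅ S'') (t : T' ≅ T'') (w : h' ≫ t.hom = s.hom ≫ h''),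
    χ h' ≫ (Ch.map ⟨cokernel.mapIso h' h'' s t w⟩ ⊗ₘ Ch.map ⟨s⟩) =
      (Ch.map ⟨t⟩ ⊗ₘ Ch.map ⟨kernel.mapIso h' h'' s t w⟩) ≫ χ h''
  /-- Compatibility with compositions: both sides are morphisms
  `(Ch(Z) ⊗ Ch(Ker g)) ⊗ Ch(Ker h) ⟶ Ch(Coker g) ⊗ (Ch(Coker h) ⊗ Ch(S))`. -/
  coherence : ∀ {S T Z : A} (h : S ⟶ T) (g : T ⟶ Z),
    χ g ▷ Ch.obj ⟨kernel h⟩ ≫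
      (α_ (Ch.obj ⟨cokernel g⟩) (Ch.obj ⟨T⟩) (Ch.obj ⟨kernel h⟩)).hom ≫
      Ch.obj ⟨cokernel g⟩ ◁ χ h =
    (α_ (Ch.obj ⟨Z⟩) (Ch.obj ⟨kernel g⟩) (Ch.obj ⟨kernel h⟩)).hom ≫
      Ch.obj ⟨Z⟩ ◁ (Ch.obj ⟨kernel g⟩ ◁ Ch.map ⟨(kerFiberMapIso h g).symm⟩) ≫
      Ch.obj ⟨Z⟩ ◁ χ (fiberMap h g) ≫
      Ch.obj ⟨Z⟩ ◁ (β_ (Ch.obj ⟨cokernel (fiberMap h g)⟩) (Ch.obj ⟨kernel (h ≫ g)⟩)).hom ≫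
      (α_ (Ch.obj ⟨Z⟩) (Ch.obj ⟨kernel (h ≫ g)⟩) (Ch.obj ⟨cokernel (fiberMap h g)⟩)).inv ≫
      (χ (h ≫ g) ⊗ₘ Ch.map ⟨rhoIso h g⟩) ≫
      (α_ (Ch.obj ⟨cokernel (h ≫ g)⟩) (Ch.obj ⟨S⟩) (Ch.obj ⟨kernel (cofiberMap h g)⟩)).hom ≫
      Ch.obj ⟨cokernel (h ≫ g)⟩ ◁ (β_ (Ch.obj ⟨S⟩) (Ch.obj ⟨kernel (cofiberMap h g)⟩)).hom ≫
      (α_ (Ch.obj ⟨cokernel (h ≫ g)⟩) (Ch.obj ⟨kernel (cofiberMap h g)⟩) (Ch.obj ⟨S⟩)).inv ≫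
      χ (cofiberMap h g) ▷ Ch.obj ⟨S⟩ ≫
      (Ch.map ⟨cokerCofiberMapIso h g⟩ ▷ Ch.obj ⟨cokernel h⟩) ▷ Ch.obj ⟨S⟩ ≫
      (α_ (Ch.obj ⟨cokernel g⟩) (Ch.obj ⟨cokernel h⟩) (Ch.obj ⟨S⟩)).hom

/-! ## Graded lines -/

/-- A graded line over `k`: a one-dimensional vector space placed in an integral degree. -/
structure GradedLine (k : Type u) [Field k] where
  deg : ℤ
  line : ModuleCat.{u} k
  finrank_line : finrank k line = 1

namespace GradedLine

variable {k : Type u} [Field k]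

/-- Morphisms of graded lines are the linear maps between lines of the same degree. -/
@[ext]
structure Hom (L M : GradedLine k) where
  deg_eq : L.deg = M.deg
  lin : L.line ⟶ M.line

instance : Category (GradedLine k) where
  Hom := Hom
  id L := ⟨rfl, 𝟙 L.line⟩
  comp f g := ⟨f.deg_eq.trans g.deg_eq, f.lin ≫ g.lin⟩
  id_comp f := Hom.ext (Category.id_comp f.lin)
  comp_id f := Hom.ext (Category.comp_id f.lin)
  assoc f g h := Hom.ext (Category.assoc f.lin g.lin h.lin)

@[ext]
lemma hom_ext {L M : GradedLine k} {f g : L ⟶ M} (e : f.lin = g.lin) : f = g := Hom.ext e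

@[simp] lemma id_lin (L : GradedLine k) : Hom.lin (𝟙 L) = 𝟙 L.line := rfl

@[simp] lemma comp_lin {L M N : GradedLine k} (f : L ⟶ M) (g : M ⟶ N) :
    (f ≫ g).lin = f.lin ≫ g.lin := rfl

/-- Isomorphisms of graded lines from isomorphisms of lines of the same degree. -/
@[simps]
def isoMk {L M : GradedLine k} (d : L.deg = M.deg) (e : L.line ≅ M.line) : L ≅ M where
  hom := ⟨d, e.hom⟩
  inv := ⟨d.symm, e.inv⟩
  hom_inv_id := hom_ext e.hom_inv_id
  inv_hom_id := hom_ext e.inv_hom_id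

/-- The tensor product of graded lines adds the degrees. -/
@[simps]
def tensor (L M : GradedLine k) : GradedLine k where
  deg := L.deg + M.deg
  line := L.line ⊗ M.line
  finrank_line := by
    change finrank k (TensorProduct k L.line M.line) = 1
    rw [finrank_tensorProduct, L.finrank_line, M.finrank_line]

/-- The unit is the ground field in degree zero. -/
@[simps]
def unit : GradedLine k where
  deg := 0
  line := 𝟙_ (ModuleCat.{u} k)
  finrank_line := finrank_self k

instance : MonoidalCategoryStruct (GradedLine k) where
  tensorObj := tensor
  tensorUnit := unit
  whiskerLeft L _ _ f := ⟨congrArg (L.deg + ·) f.deg_eq, L.line ◁ f.lin⟩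
  whiskerRight f L := ⟨congrArg (· + L.deg) f.deg_eq, f.lin ▷ L.line⟩
  tensorHom f g := ⟨congrArg₂ (· + ·) f.deg_eq g.deg_eq, f.lin ⊗ₘ g.lin⟩
  associator L M N := isoMk (add_assoc _ _ _) (α_ L.line M.line N.line)
  leftUnitor L := isoMk (zero_add _) (λ_ L.line)
  rightUnitor L := isoMk (add_zero _) (ρ_ L.line)

instance : MonoidalCategory (GradedLine k) where
  tensorHom_def f g := hom_ext (MonoidalCategory.tensorHom_def f.lin g.lin)
  id_tensorHom_id L M := hom_ext (MonoidalCategory.id_tensorHom_id L.line M.line)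
  tensorHom_comp_tensorHom f g f' g' :=
    hom_ext (MonoidalCategory.tensorHom_comp_tensorHom f.lin g.lin f'.lin g'.lin)
  whiskerLeft_id L M := hom_ext (MonoidalCategory.whiskerLeft_id L.line M.line)
  id_whiskerRight L M := hom_ext (MonoidalCategory.id_whiskerRight L.line M.line)
  associator_naturality f g h :=
    hom_ext (MonoidalCategory.associator_naturality f.lin g.lin h.lin)
  leftUnitor_naturality f := hom_ext (MonoidalCategory.leftUnitor_naturality f.lin)
  rightUnitor_naturality f := hom_ext (MonoidalCategory.rightUnitor_naturality f.lin)
  pentagon L M N P := hom_ext (MonoidalCategory.pentagon L.line M.line N.line P.line)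
  triangle L M := hom_ext (MonoidalCategory.triangle L.line M.line)

/-- The Koszul sign `(-1) ^ (m * n)`. -/
def sign (k : Type u) [Field k] (m n : ℤ) : kˣ := (-1) ^ (m * n)

lemma sign_mul_sign (m n : ℤ) : sign k m n * sign k n m = 1 := by
  simp only [sign]
  rw [mul_comm n m, ← zpow_add, ← two_mul, zpow_mul]
  simp

lemma sign_add_left (l m n : ℤ) : sign k (l + m) n = sign k l n * sign k m n := by
  simp only [sign]; rw [add_mul, zpow_add]

lemma sign_add_right (l m n : ℤ) : sign k l (m + n) = sign k l m * sign k l n := by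
  simp only [sign]; rw [mul_add, zpow_add]

/-- The flip `x ⊗ y ↦ y ⊗ x`, rescaled by a unit. -/
@[simps]
def scaledFlip (a : kˣ) (L M : ModuleCat.{u} k) : L ⊗ M ≅ M ⊗ L where
  hom := (a : k) • (β_ L M).hom
  inv := ((a⁻¹ : kˣ) : k) • (β_ L M).inv
  hom_inv_id := by
    rw [Linear.smul_comp, Linear.comp_smul, smul_smul, ← Units.val_mul, mul_inv_cancel,
      Iso.hom_inv_id, Units.val_one, one_smul]
  inv_hom_id := by
    rw [Linear.smul_comp, Linear.comp_smul, smul_smul, ← Units.val_mul, inv_mul_cancel,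
      Iso.inv_hom_id, Units.val_one, one_smul]

/-- The symmetry of graded lines with the Koszul sign,
`x ⊗ y ↦ (-1) ^ (deg x * deg y) • y ⊗ x`. -/
def braid (L M : GradedLine k) : L ⊗ M ≅ M ⊗ L :=
  isoMk (add_comm L.deg M.deg) (scaledFlip (sign k L.deg M.deg) L.line M.line)

lemma smul_swap_comp_smul_swap (a b : k) (hab : a * b = 1) (L M : ModuleCat.{u} k) :
    (a • (β_ L M).hom) ≫ (b • (β_ M L).hom) = 𝟙 (L ⊗ M) := by
  rw [Linear.smul_comp, Linear.comp_smul, smul_smul, hab, SymmetricCategory.symmetry, one_smul]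

lemma hexagon_forward_smul (a b : k) (L M N : ModuleCat.{u} k) :
    (α_ L M N).hom ≫ ((a * b) • (β_ L (M ⊗ N)).hom) ≫ (α_ M N L).hom =
      ((a • (β_ L M).hom) ▷ N) ≫ (α_ M L N).hom ≫ (M ◁ (b • (β_ L N).hom)) := by
  rw [MonoidalLinear.whiskerLeft_smul, MonoidalLinear.smul_whiskerRight]
  simp only [Linear.smul_comp, Linear.comp_smul, smul_smul]
  rw [mul_comm b a, BraidedCategory.hexagon_forward]

lemma hexagon_reverse_smul (a b : k) (L M N : ModuleCat.{u} k) :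
    (α_ L M N).inv ≫ ((a * b) • (β_ (L ⊗ M) N).hom) ≫ (α_ N L M).inv =
      (L ◁ (a • (β_ M N).hom)) ≫ (α_ L N M).inv ≫ ((b • (β_ L N).hom) ▷ M) := by
  rw [MonoidalLinear.whiskerLeft_smul, MonoidalLinear.smul_whiskerRight]
  simp only [Linear.smul_comp, Linear.comp_smul, smul_smul]
  rw [mul_comm b a, BraidedCategory.hexagon_reverse]

instance : SymmetricCategory (GradedLine k) where
  braiding := braid
  braiding_naturality_right L M N f := hom_ext (by
    change (L.line ◁ f.lin) ≫ (scaledFlip (sign k L.deg N.deg) L.line N.line).hom =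
      (scaledFlip (sign k L.deg M.deg) L.line M.line).hom ≫ (f.lin ▷ L.line)
    rw [scaledFlip_hom, scaledFlip_hom, Linear.smul_comp, Linear.comp_smul, f.deg_eq,
      BraidedCategory.braiding_naturality_right])
  braiding_naturality_left {L M} f N := hom_ext (by
    change (f.lin ▷ N.line) ≫ (scaledFlip (sign k M.deg N.deg) M.line N.line).hom =
      (scaledFlip (sign k L.deg N.deg) L.line N.line).hom ≫ (N.line ◁ f.lin)
    rw [scaledFlip_hom, scaledFlip_hom, Linear.smul_comp, Linear.comp_smul, f.deg_eq,
      BraidedCategory.braiding_naturality_left])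
  hexagon_forward L M N := hom_ext (by
    refine Eq.trans ?_ (hexagon_forward_smul (sign k L.deg M.deg : k) (sign k L.deg N.deg : k)
      L.line M.line N.line)
    rw [← Units.val_mul, ← sign_add_right]
    rfl)
  hexagon_reverse L M N := hom_ext (by
    refine Eq.trans ?_ (hexagon_reverse_smul (sign k M.deg N.deg : k) (sign k L.deg N.deg : k)
      L.line M.line N.line)
    rw [mul_comm, ← Units.val_mul, ← sign_add_left]
    rfl)
  symmetry L M := hom_ext
    (smul_swap_comp_smul_swap _ _ (by rw [← Units.val_mul, sign_mul_sign L.deg M.deg, Units.val_one])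
      L.line M.line)

end GradedLine

/-! ## Determinants of vector spaces -/

namespace Determinant

section Modules

variable (k : Type u) [Field k]
variable (M : Type v) [AddCommGroup M] [Module k M]

/-- The top exterior power of a finite-dimensional vector space. -/
abbrev Top : Submodule k (ExteriorAlgebra k M) := ⋀[k]^(finrank k M) M

lemma finrank_top [FiniteDimensional k M] : finrank k (Top k M) = 1 := by
  rw [exteriorPower.finrank_eq, Nat.choose_self]

variable {k M}
variable {M' M'' N P : Type v} [AddCommGroup M'] [Module k M'] [AddCommGroup M''] [Module k M'']
  [AddCommGroup N] [Module k N] [AddCommGroup P] [Module k P]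

lemma coe_map (n : ℕ) (f : M →ₗ[k] N) (x : ⋀[k]^n M) :
    (exteriorPower.map n f x : ExteriorAlgebra k N) = ExteriorAlgebra.map f x := by
  have e : (⋀[k]^n N).subtype ∘ₗ exteriorPower.map n f =
      (ExteriorAlgebra.map f).toLinearMap ∘ₗ (⋀[k]^n M).subtype := by
    apply exteriorPower.linearMap_ext
    ext v
    simp [exteriorPower.map_apply_ιMulti]
  exact LinearMap.congr_fun e x

/-- The isomorphism of top exterior powers induced by a linear isomorphism `e`: the restriction
of the map induced by `e` on the exterior algebras. -/
def topMap (e : M ≃ₗ[k] N) : Top k M ≃ₗ[k] Top k N where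
  toFun x := ⟨exteriorPower.map (finrank k M) e.toLinearMap x, by
    exact (congrArg (fun n => ⋀[k]^n N) e.finrank_eq).le (SetLike.coe_mem _)⟩
  invFun y := ⟨exteriorPower.map (finrank k N) e.symm.toLinearMap y, by
    exact (congrArg (fun n => ⋀[k]^n M) e.finrank_eq).ge (SetLike.coe_mem _)⟩
  map_add' x y := by ext; simp
  map_smul' a x := by ext; simp
  left_inv x := by
    ext
    rw [coe_map, coe_map, ← AlgHom.comp_apply, ExteriorAlgebra.map_comp_map]
    simp
  right_inv y := by
    ext
    rw [coe_map, coe_map, ← AlgHom.comp_apply, ExteriorAlgebra.map_comp_map]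
    simp

lemma coe_topMap (e : M ≃ₗ[k] N) (x : Top k M) :
    (topMap e x : ExteriorAlgebra k N) = ExteriorAlgebra.map e.toLinearMap x :=
  coe_map (finrank k M) e.toLinearMap x

/-- The wedge product `⋀^p M ⊗ ⋀^q M ⟶ ⋀^n M`, `n = p + q`. -/
def wedge (p q n : ℕ) (hn : n = p + q) :
    TensorProduct k (⋀[k]^p M) (⋀[k]^q M) →ₗ[k] ⋀[k]^n M :=
  (TensorProduct.lift ((LinearMap.mul k (ExteriorAlgebra k M)).compl₁₂
    (⋀[k]^p M).subtype (⋀[k]^q M).subtype)).codRestrict _ (fun x => by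
      induction x with
      | zero => simp
      | add x y hx hy => rw [map_add]; exact add_mem hx hy
      | tmul x y =>
        subst hn
        simpa [pow_add] using Submodule.mul_mem_mul x.2 y.2)

/-- For a surjection `π : M ⟶ M'` with kernel `i : M'' ⟶ M` and a linear section `σ` of `π`,
the map `x' ⊗ x'' ↦ σ(x') ∧ i(x'')`. -/
def sectionWedge (i : M'' →ₗ[k] M) (σ : M' →ₗ[k] M)
    (hn : finrank k M = finrank k M' + finrank k M'') :
    TensorProduct k (Top k M') (Top k M'') →ₗ[k] Top k M :=
  wedge _ _ _ hn ∘ₗ TensorProduct.map (exteriorPower.map _ σ) (exteriorPower.map _ i)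

lemma coe_wedge_tmul {p q n : ℕ} (hn : n = p + q) (x : ⋀[k]^p M) (y : ⋀[k]^q M) :
    (wedge p q n hn (x ⊗ₜ y) : ExteriorAlgebra k M) = x * y := rfl

lemma coe_sectionWedge_tmul (i : M'' →ₗ[k] M) (σ : M' →ₗ[k] M)
    (hn : finrank k M = finrank k M' + finrank k M'') (x : Top k M') (y : Top k M'') :
    (sectionWedge i σ hn (x ⊗ₜ y) : ExteriorAlgebra k M) =
      ExteriorAlgebra.map σ x * ExteriorAlgebra.map i y := by
  rw [← coe_map, ← coe_map]; rfl

lemma ι_mul_top [FiniteDimensional k M] (m : M) (y : Top k M) :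
    ExteriorAlgebra.ι k m * (y : ExteriorAlgebra k M) = 0 := by
  have e : LinearMap.mulLeft k (ExteriorAlgebra.ι k m) ∘ₗ (Top k M).subtype = 0 := by
    apply exteriorPower.linearMap_ext
    ext v
    have : ExteriorAlgebra.ιMulti k _ (Matrix.vecCons m v) = 0 := by
      apply AlternatingMap.map_linearDependent
      intro hl
      have := hl.fintype_card_le_finrank
      simp at this
    simpa [ExteriorAlgebra.ιMulti_succ_apply] using this
  exact LinearMap.congr_fun e y

lemma ι_mul_prod_mul (m : M) (y : ExteriorAlgebra k M) (hy : ExteriorAlgebra.ι k m * y = 0)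
    (l : List M) : ExteriorAlgebra.ι k m * ((l.map (ExteriorAlgebra.ι k)).prod * y) = 0 := by
  induction l with
  | nil => simpa using hy
  | cons a l ih =>
    have := ExteriorAlgebra.ι_add_mul_swap (R := k) m a
    rw [List.map_cons, List.prod_cons, mul_assoc, ← mul_assoc, eq_neg_of_add_eq_zero_left this,
      neg_mul, mul_assoc, ih, mul_zero, neg_zero]

lemma prod_add_mul (i : M'' →ₗ[k] M) (y : ExteriorAlgebra k M)
    (hy : ∀ m, ExteriorAlgebra.ι k (i m) * y = 0) (l : List (M × M'')) :
    (l.map (fun z => ExteriorAlgebra.ι k (z.1 + i z.2))).prod * y =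
      (l.map (fun z => ExteriorAlgebra.ι k z.1)).prod * y := by
  induction l with
  | nil => rfl
  | cons a l ih =>
    have h0 := ι_mul_prod_mul (i a.2) y (hy _) (l.map Prod.fst)
    rw [List.map_map] at h0
    rw [List.map_cons, List.prod_cons, List.map_cons, List.prod_cons, mul_assoc, mul_assoc, ih,
      map_add, add_mul]
    exact (congrArg _ h0).trans (add_zero _)

/-- The map `sectionWedge` may be computed with arbitrary lifts along `π`:
`(π u₁ ∧ ⋯ ∧ π uₚ) ⊗ y ↦ u₁ ∧ ⋯ ∧ uₚ ∧ i(y)`. In particular it does not depend on `σ`. -/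
lemma coe_sectionWedge_ιMulti [FiniteDimensional k M''] (i : M'' →ₗ[k] M) (π : M →ₗ[k] M')
    (hex : Function.Exact i π) (σ : M' →ₗ[k] M) (hσ : π ∘ₗ σ = LinearMap.id)
    (hn : finrank k M = finrank k M' + finrank k M'')
    (u : Fin (finrank k M') → M) (y : Top k M'') :
    (sectionWedge i σ hn (exteriorPower.ιMulti k _ (fun j => π (u j)) ⊗ₜ y) :
      ExteriorAlgebra k M) = ExteriorAlgebra.ιMulti k _ u * ExteriorAlgebra.map i y := by
  have hw : ∀ j, ∃ w, i w = σ (π (u j)) - u j := fun j => by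
    apply (hex _).1
    rw [map_sub, ← LinearMap.comp_apply π σ, hσ, LinearMap.id_apply, sub_self]
  choose w hw using hw
  rw [coe_sectionWedge_tmul, exteriorPower.ιMulti_apply_coe, ExteriorAlgebra.map_apply_ιMulti,
    ExteriorAlgebra.ιMulti_apply, ExteriorAlgebra.ιMulti_apply]
  have h := prod_add_mul i (ExteriorAlgebra.map i y) (fun m => by
    rw [← ExteriorAlgebra.map_apply_ι, ← map_mul, ι_mul_top, map_zero])
    (List.ofFn fun j => (u j, w j))
  simpa [List.map_ofFn, Function.comp_def, hw] using h

lemma sectionWedge_bijective [FiniteDimensional k M] [FiniteDimensional k M']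
    [FiniteDimensional k M''] (i : M'' →ₗ[k] M) (π : M →ₗ[k] M') (hex : Function.Exact i π)
    (σ : M' →ₗ[k] M) (hσ : π ∘ₗ σ = LinearMap.id)
    (hn : finrank k M = finrank k M' + finrank k M'') :
    Function.Bijective (sectionWedge i σ hn) := by
  have hfr : finrank k (TensorProduct k (Top k M') (Top k M'')) = finrank k (Top k M) := by
    rw [finrank_tensorProduct, finrank_top, finrank_top, finrank_top]
  have : FiniteDimensional k (TensorProduct k (Top k M') (Top k M'')) :=
    inferInstance
  suffices hs : Function.Surjective (sectionWedge i σ hn) from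
    ⟨OrzechProperty.injective_of_surjective_of_injective
      (LinearEquiv.ofFinrankEq _ _ hfr).toLinearMap _ (LinearEquiv.injective _) hs, hs⟩
  let b' := finBasis k M'
  let b'' := finBasis k M''
  let e := Fin.append (fun j => σ (b' j)) (fun j => i (b'' j))
  have hspan : ⊤ ≤ Submodule.span k (Set.range e) := by
    intro m _
    have h1 : ∀ x, σ x ∈ Submodule.span k (Set.range e) := fun x => by
      have : Submodule.map σ (Submodule.span k (Set.range b')) ≤ Submodule.span k (Set.range e) := by
        rw [Submodule.map_span_le]
        rintro _ ⟨j, rfl⟩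
        exact Submodule.subset_span ⟨Fin.castAdd _ j, Fin.append_left _ _ j⟩
      exact this ⟨x, by rw [b'.span_eq]; trivial, rfl⟩
    have h2 : ∀ x, i x ∈ Submodule.span k (Set.range e) := fun x => by
      have : Submodule.map i (Submodule.span k (Set.range b'')) ≤ Submodule.span k (Set.range e) := by
        rw [Submodule.map_span_le]
        rintro _ ⟨j, rfl⟩
        exact Submodule.subset_span ⟨Fin.natAdd _ j, Fin.append_right _ _ j⟩
      exact this ⟨x, by rw [b''.span_eq]; trivial, rfl⟩
    obtain ⟨w, hw⟩ := (hex (m - σ (π m))).1 (by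
      rw [map_sub, ← LinearMap.comp_apply π σ, hσ, LinearMap.id_apply, sub_self])
    rw [← sub_add_cancel m (σ (π m)), ← hw]
    exact add_mem (h2 w) (h1 _)
  let E := basisOfTopLeSpanOfCardEqFinrank e hspan (by rw [Fintype.card_fin, hn])
  have hf : ExteriorAlgebra.ιMulti k (finrank k M' + finrank k M'') (M := M) ≠ 0 := by
    intro h0
    have h1 : finrank k (⋀[k]^(finrank k M' + finrank k M'') M : Submodule k _) = 1 :=
      hn ▸ finrank_top k M
    rw [← ExteriorAlgebra.ιMulti_span_fixedDegree, h0] at h1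
    have : Set.range (0 : M [⋀^Fin (finrank k M' + finrank k M'')]→ₗ[k] ExteriorAlgebra k M)
        ⊆ {0} := by
      rintro _ ⟨v, rfl⟩; rfl
    rw [Submodule.span_eq_bot.2 (fun x hx => this hx), finrank_bot] at h1
    exact zero_ne_one h1
  have hE : ExteriorAlgebra.ιMulti k (finrank k M' + finrank k M'') E ≠ 0 := fun h =>
    hf (Basis.ext_alternating E fun j hj => by
      let τ : Equiv.Perm (Fin (finrank k M' + finrank k M'')) :=
        Equiv.ofBijective j (Finite.injective_iff_bijective.1 hj)
      change ExteriorAlgebra.ιMulti k (finrank k M' + finrank k M'') (E ∘ τ) = 0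
      rw [AlternatingMap.map_perm, h, smul_zero])
  suffices hne : sectionWedge i σ hn
      (exteriorPower.ιMulti k _ b' ⊗ₜ exteriorPower.ιMulti k _ b'') ≠ 0 by
    intro z
    obtain ⟨c, rfl⟩ := (finrank_eq_one_iff_of_nonzero' _ hne).1 (finrank_top k M) z
    exact ⟨c • _, map_smul _ _ _⟩
  intro h0
  apply hE
  have h1 : (sectionWedge i σ hn (exteriorPower.ιMulti k _ b' ⊗ₜ exteriorPower.ιMulti k _ b'') :
      ExteriorAlgebra k M) = 0 := by rw [h0]; rfl
  rw [coe_sectionWedge_tmul] at h1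
  rw [exteriorPower.ιMulti_apply_coe, exteriorPower.ιMulti_apply_coe,
    ExteriorAlgebra.map_apply_ιMulti, ExteriorAlgebra.map_apply_ιMulti,
    ExteriorAlgebra.ιMulti_apply, ExteriorAlgebra.ιMulti_apply, ← List.prod_append,
    ← List.ofFn_fin_append] at h1
  rw [coe_basisOfTopLeSpanOfCardEqFinrank, ExteriorAlgebra.ιMulti_apply, ← h1]
  congr 2
  funext j
  refine Fin.addCases (fun j => ?_) (fun j => ?_) j
  · simp [e]
  · simp [e]

end Modules

section Category

variable {k : Type u} [Field k]

/-- The determinant of a finite-dimensional vector space: its top exterior power, placed in degree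
the dimension. -/
@[simps]
def detObj (S : FGModuleCat.{u} k) : GradedLine k where
  deg := finrank k S
  line := ModuleCat.of k (Top k S)
  finrank_line := finrank_top k S

variable (k) in
/-- The determinant as a functor on the isomorphisms of finite-dimensional vector spaces. -/
def detFunctor : Core (FGModuleCat.{u} k) ⥤ GradedLine k where
  obj S := detObj S.of
  map f := ⟨congrArg Nat.cast (FGModuleCat.isoToLinearEquiv f.iso).finrank_eq,
    ModuleCat.ofHom (topMap (FGModuleCat.isoToLinearEquiv f.iso)).toLinearMap⟩
  map_id S := by
    apply GradedLine.hom_ext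
    apply ModuleCat.hom_ext
    ext x
    apply Subtype.ext
    exact (coe_topMap _ _).trans (DFunLike.congr_fun ExteriorAlgebra.map_id _)
  map_comp f g := by
    apply GradedLine.hom_ext
    apply ModuleCat.hom_ext
    ext x
    apply Subtype.ext
    refine ((coe_topMap _ _).trans ?_).trans (coe_topMap _ _).symm
    refine Eq.trans ?_ (congrArg _ (coe_topMap _ _).symm)
    exact (DFunLike.congr_fun (ExteriorAlgebra.map_comp_map _ _) _).symm

section ShortExact

variable (X : ShortComplex (FGModuleCat.{u} k))

lemma exact_of_shortExact (hX : X.ShortExact) : Function.Exact X.f.hom.hom X.g.hom.hom :=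
  (ShortComplex.ShortExact.moduleCat_exact_iff_function_exact _).1
    (hX.map_of_exact (forget₂ (FGModuleCat.{u} k) (ModuleCat.{u} k))).exact

lemma injective_of_shortExact (hX : X.ShortExact) : Function.Injective X.f.hom.hom :=
  (hX.map_of_exact (forget₂ (FGModuleCat.{u} k) (ModuleCat.{u} k))).moduleCat_injective_f

lemma surjective_of_shortExact (hX : X.ShortExact) : Function.Surjective X.g.hom.hom :=
  (hX.map_of_exact (forget₂ (FGModuleCat.{u} k) (ModuleCat.{u} k))).moduleCat_surjective_g

lemma exists_section (hX : X.ShortExact) : ∃ σ : X.X₃ →ₗ[k] X.X₂, X.g.hom.hom ∘ₗ σ = LinearMap.id :=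
  LinearMap.exists_rightInverse_of_surjective _
    (LinearMap.range_eq_top.2 (surjective_of_shortExact X hX))

lemma finrank_of_shortExact (hX : X.ShortExact) : finrank k X.X₂ = finrank k X.X₃ + finrank k X.X₁ := by
  have h1 := LinearMap.finrank_range_add_finrank_ker X.g.hom.hom
  rw [LinearMap.range_eq_top.2 (surjective_of_shortExact X hX),
    LinearMap.exact_iff.1 (exact_of_shortExact X hX),
    LinearMap.finrank_range_of_inj (injective_of_shortExact X hX), _root_.finrank_top] at h1
  exact h1.symm

/-- The isomorphism `det S' ⊗ det S'' ≅ det S` induced by a short exact sequence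
`0 ⟶ S'' ⟶ S ⟶ S' ⟶ 0`. It sends `x' ⊗ x''` to the wedge product, in this order, of a lift of `x'`
and of the image of `x''`; the choice of the lift is irrelevant. -/
def detSES (hX : X.ShortExact) : detObj X.X₃ ⊗ detObj X.X₁ ≅ detObj X.X₂ :=
  GradedLine.isoMk (by
      change (finrank k X.X₃ : ℤ) + finrank k X.X₁ = finrank k X.X₂
      rw [finrank_of_shortExact X hX, Nat.cast_add])
    (LinearEquiv.toModuleIso (LinearEquiv.ofBijective
      (sectionWedge X.f.hom.hom (exists_section X hX).choose (finrank_of_shortExact X hX))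
      (sectionWedge_bijective X.f.hom.hom X.g.hom.hom (exact_of_shortExact X hX) _
        (exists_section X hX).choose_spec (finrank_of_shortExact X hX))))

/-- The explicit value of `detSES`, independent of choices:
`(π u₁ ∧ ⋯ ∧ π uₚ) ⊗ (v₁ ∧ ⋯ ∧ v_q) ↦ u₁ ∧ ⋯ ∧ uₚ ∧ i v₁ ∧ ⋯ ∧ i v_q`. -/
lemma detSES_apply (hX : X.ShortExact)
    (u : Fin (finrank k X.X₃) → X.X₂) (v : Fin (finrank k X.X₁) → X.X₁) :
    (Top k X.X₂).subtype ((detSES X hX).hom.lin.hom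
      (exteriorPower.ιMulti k _ (fun j => X.g.hom.hom (u j)) ⊗ₜ exteriorPower.ιMulti k _ v)) =
    ExteriorAlgebra.ιMulti k _ u * ExteriorAlgebra.ιMulti k _ (fun j => X.f.hom.hom (v j)) := by
  refine (coe_sectionWedge_ιMulti _ _ (exact_of_shortExact X hX) _
    (exists_section X hX).choose_spec (finrank_of_shortExact X hX) u _).trans ?_
  rw [exteriorPower.ιMulti_apply_coe, ExteriorAlgebra.map_apply_ιMulti]
  rfl

end ShortExact

variable {S T : FGModuleCat.{u} k} (h : S ⟶ T)

/-- The sequence `0 ⟶ Ker h ⟶ S ⟶ Im h ⟶ 0`. -/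
def kerSES : ShortComplex (FGModuleCat.{u} k) :=
  ShortComplex.mk (kernel.ι h) (Abelian.factorThruImage h)
    (by rw [← cancel_mono (Abelian.image.ι h)]; simp)

lemma kerSES_shortExact : (kerSES h).ShortExact where
  exact := ShortComplex.exact_of_f_is_kernel _
    (isKernelOfComp (Abelian.image.ι h) h (kernelIsKernel h) _ (Abelian.image.fac h))
  mono_f := inferInstanceAs (Mono (kernel.ι h))
  epi_g := inferInstanceAs (Epi (Abelian.factorThruImage h))

/-- The sequence `0 ⟶ Im h ⟶ T ⟶ Coker h ⟶ 0`. -/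
def cokerSES : ShortComplex (FGModuleCat.{u} k) :=
  ShortComplex.mk (Abelian.image.ι h) (cokernel.π h) (kernel.condition _)

lemma cokerSES_shortExact : (cokerSES h).ShortExact where
  exact := ShortComplex.exact_of_f_is_kernel _ (kernelIsKernel (cokernel.π h))
  mono_f := inferInstanceAs (Mono (Abelian.image.ι h))
  epi_g := inferInstanceAs (Epi (cokernel.π h))

/-- The isomorphism `det (Im h) ⊗ det (Ker h) ≅ det S`. -/
def detKer : detObj (Abelian.image h) ⊗ detObj (kernel h) ≅ detObj S :=
  detSES (kerSES h) (kerSES_shortExact h)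

/-- The isomorphism `det (Coker h) ⊗ det (Im h) ≅ det T`. -/
def detCoker : detObj (cokernel h) ⊗ detObj (Abelian.image h) ≅ detObj T :=
  detSES (cokerSES h) (cokerSES_shortExact h)

/-- The isomorphism `χ_h : det T ⊗ det (Ker h) ≅ det (Coker h) ⊗ det S`, through
`det (Coker h) ⊗ det (Im h) ⊗ det (Ker h)`. -/
def detChi : detObj T ⊗ detObj (kernel h) ≅ detObj (cokernel h) ⊗ detObj S :=
  whiskerRightIso (detCoker h).symm (detObj (kernel h)) ≪≫
    α_ (detObj (cokernel h)) (detObj (Abelian.image h)) (detObj (kernel h)) ≪≫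
    whiskerLeftIso (detObj (cokernel h)) (detKer h)

end Category

end Determinant

end

/-!
The category of graded lines has one-dimensional objects, so two parallel morphisms agree as soon as
they agree on one nonzero element. Everything therefore reduces to evaluating the isomorphisms
`χ_h` on well-chosen elements, and these are computed with multivectors, without choosing
splittings: if `c` and `i` are multivectors of `T` and of `S`, of degrees `dim (Coker h)` and
`dim (Im h)`, then
`χ_h ((c ∧ h i) ⊗ f) = π c ⊗ (i ∧ f)` for `f` in `det (Ker h)` (`Determinant.ap_detChi`).
Such elements `c ∧ h i` generate `det T` (`Determinant.exists_lift_image`). Naturality is immediate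
from this formula.

For the coherence relation of `h : S ⟶ T` and `g : T ⟶ Z`, take multivectors `e` of `Z`, `t` of `T`,
`i` of `S`, `b` of `Ker g` and `a` of `Ker (g ∘ h)` which lift generators of the determinants of
`Coker g`, `Im g^S`, `Im (g ∘ h)`, `Coker h_Z` and `Im h_Z`, and a generator `f` of `det (Ker h)`.
Both sides are evaluated on `(e ∧ g t ∧ g h i) ⊗ (b ∧ h a) ⊗ f`, and up to a sign both give
`e ⊗ (t ∧ b) ⊗ (i ∧ a ∧ f)`, where `e` and `t ∧ b` are projected to `Coker g` and `Coker h`.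
On the left `χ_h` can be applied only after moving `h i` past `b`, which costs the sign
`(-1) ^ (rank (g ∘ h) * dim (Coker h_Z))`. On the right `b` is moved past `a ∧ f` by the
first symmetry and past `i ∧ a ∧ f` by the second one, with the same total sign.
-/

/-! ### Degrees and signs in exterior algebras -/

namespace ExteriorAlgebra

variable {k : Type u} [Field k] {M : Type v} [AddCommGroup M] [Module k M]

lemma map_mem_exteriorPower {N : Type*} [AddCommGroup N] [Module k N] (f : M →ₗ[k] N) {n : ℕ}
    {x : ExteriorAlgebra k M} (hx : x ∈ ⋀[k]^n M) : map f x ∈ ⋀[k]^n N := by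
  have h : (⋀[k]^n M).map (map f).toLinearMap ≤ ⋀[k]^n N := by
    rw [exteriorPower, exteriorPower, Submodule.map_pow]
    refine pow_le_pow_left' ?_ n
    rintro _ ⟨_, ⟨m, rfl⟩, rfl⟩
    exact ⟨f m, (map_apply_ι f m).symm⟩
  exact h ⟨x, hx, rfl⟩

lemma mul_mem_exteriorPower {m n : ℕ} {x y : ExteriorAlgebra k M} (hx : x ∈ ⋀[k]^m M)
    (hy : y ∈ ⋀[k]^n M) : x * y ∈ ⋀[k]^(m + n) M := by
  rw [exteriorPower, pow_add]
  exact Submodule.mul_mem_mul hx hy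

lemma ι_mul_eq_pow_smul {n : ℕ} (m : M) {y : ExteriorAlgebra k M} (hy : y ∈ ⋀[k]^n M) :
    ι k m * y = (-1 : k) ^ n • (y * ι k m) := by
  induction hy using Submodule.pow_induction_on_left' with
  | algebraMap r => simp [Algebra.commutes]
  | add x y i hx hy ihx ihy => rw [mul_add, ihx, ihy, add_mul, smul_add]
  | mem_mul a ha i x hx ih =>
    obtain ⟨a, rfl⟩ := ha
    rw [← mul_assoc, eq_neg_of_add_eq_zero_left (ι_add_mul_swap (R := k) m a), neg_mul, mul_assoc,
      ih, mul_smul_comm, pow_succ, mul_neg_one, neg_smul, mul_assoc]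

/-- The exterior algebra is graded commutative. -/
lemma mul_eq_pow_smul_mul {m n : ℕ} {x y : ExteriorAlgebra k M} (hx : x ∈ ⋀[k]^m M)
    (hy : y ∈ ⋀[k]^n M) : x * y = (-1 : k) ^ (m * n) • (y * x) := by
  induction hx using Submodule.pow_induction_on_left' with
  | algebraMap r => simp [Algebra.commutes]
  | add x x' i hx hx' ihx ihx' => rw [add_mul, ihx, ihx', mul_add, smul_add]
  | mem_mul a ha i x hx ih =>
    obtain ⟨a, rfl⟩ := ha
    rw [mul_assoc, ih, mul_smul_comm, ← mul_assoc, ι_mul_eq_pow_smul a hy, smul_mul_assoc,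
      smul_smul, ← pow_add, mul_assoc, Nat.succ_mul]

end ExteriorAlgebra

/-! ### Elements of graded lines -/

namespace GradedLine

variable {k : Type u} [Field k] {L M N P : GradedLine k}

/-- The element `x ⊗ y` of a tensor product of graded lines. -/
def tmul (x : L.line) (y : M.line) : (L ⊗ M : GradedLine k).line := TensorProduct.tmul k x y

/-- The value of a morphism of graded lines on an element. -/
def Hom.ap (f : L ⟶ M) (x : L.line) : M.line := f.lin.hom x

lemma ap_comp (f : L ⟶ M) (g : M ⟶ N) (x : L.line) :
    Hom.ap (f ≫ g) x = Hom.ap g (Hom.ap f x) := rfl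

lemma ap_smul (f : L ⟶ M) (a : k) (x : L.line) : Hom.ap f (a • x) = a • Hom.ap f x :=
  map_smul f.lin.hom a x

lemma ap_whiskerLeft (f : M ⟶ N) (x : L.line) (y : M.line) :
    Hom.ap (L ◁ f) (tmul x y) = tmul x (Hom.ap f y) := rfl

lemma ap_whiskerRight (f : M ⟶ N) (x : M.line) (y : L.line) :
    Hom.ap (f ▷ L) (tmul x y) = tmul (Hom.ap f x) y := rfl

lemma ap_tensorHom (f : L ⟶ M) (g : N ⟶ P) (x : L.line) (y : N.line) :
    Hom.ap (f ⊗ₘ g) (tmul x y) = tmul (Hom.ap f x) (Hom.ap g y) := rfl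

lemma ap_associator_hom (x : L.line) (y : M.line) (z : N.line) :
    Hom.ap (α_ L M N).hom (tmul (tmul x y) z) = tmul x (tmul y z) := rfl

lemma ap_associator_inv (x : L.line) (y : M.line) (z : N.line) :
    Hom.ap (α_ L M N).inv (tmul x (tmul y z)) = tmul (tmul x y) z := rfl

lemma ap_braiding (x : L.line) (y : M.line) :
    Hom.ap (β_ L M).hom (tmul x y) = (sign k L.deg M.deg : k) • tmul y x := rfl

lemma tmul_smul (a : k) (x : L.line) (y : M.line) : tmul x (a • y) = a • tmul x y :=
  TensorProduct.tmul_smul a x y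

lemma smul_tmul (a : k) (x : L.line) (y : M.line) : tmul (a • x) y = a • tmul x y :=
  (TensorProduct.smul_tmul' a x y).symm

lemma ap_hom_ne_zero (e : L ≅ M) {x : L.line} (hx : x ≠ 0) : Hom.ap e.hom x ≠ 0 := fun h => by
  apply hx
  have h' : Hom.ap e.inv (Hom.ap e.hom x) = x := by rw [← ap_comp, e.hom_inv_id]; rfl
  rw [← h', h]
  exact map_zero e.inv.lin.hom

lemma tmul_ne_zero {x : L.line} {y : M.line} (hx : x ≠ 0) (hy : y ≠ 0) : tmul x y ≠ 0 := by
  obtain ⟨p, hp⟩ := not_forall.1 (mt (forall_dual_apply_eq_zero_iff k x).1 hx)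
  obtain ⟨q, hq⟩ := not_forall.1 (mt (forall_dual_apply_eq_zero_iff k y).1 hy)
  intro h
  have h' := congrArg (LinearMap.mul' k k ∘ₗ TensorProduct.map p q) h
  exact mul_ne_zero hp hq (h'.trans (map_zero _))

lemma exists_ne_zero (L : GradedLine k) : ∃ x : L.line, x ≠ 0 := by
  have : Nontrivial L.line := nontrivial_of_finrank_pos (R := k) (by rw [L.finrank_line]; simp)
  exact _root_.exists_ne 0

/-- Two morphisms of graded lines agree if they agree on a nonzero element. -/
lemma hom_eq_of_ap_eq {f g : L ⟶ M} {x : L.line} (hx : x ≠ 0) (h : Hom.ap f x = Hom.ap g x) :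
    f = g := by
  apply hom_ext
  apply ModuleCat.hom_ext
  ext y
  obtain ⟨c, rfl⟩ := (finrank_eq_one_iff_of_nonzero' x hx).1 L.finrank_line y
  exact (ap_smul f c x).trans ((congrArg _ h).trans (ap_smul g c x).symm)

end GradedLine

namespace Determinant

open GradedLine KerCoker

variable {k : Type u} [Field k]

/-! ### Determinants of short exact sequences via multivectors -/

section LinearAlgebra

variable {M M' M'' : Type v} [AddCommGroup M] [Module k M] [AddCommGroup M'] [Module k M']
  [AddCommGroup M''] [Module k M'']

/-- The map `sectionWedge` may be computed with arbitrary lifts of multivectors along `π`. -/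
lemma coe_sectionWedge_lift [FiniteDimensional k M''] (i : M'' →ₗ[k] M) (π : M →ₗ[k] M')
    (hex : Function.Exact i π) (σ : M' →ₗ[k] M) (hσ : π ∘ₗ σ = LinearMap.id)
    (hn : finrank k M = finrank k M' + finrank k M'')
    (u : ⋀[k]^(finrank k M') M) (y : Top k M'') :
    (sectionWedge i σ hn (exteriorPower.map _ π u ⊗ₜ y) : ExteriorAlgebra k M) =
      u * ExteriorAlgebra.map i y := by
  have e : (Top k M).subtype ∘ₗ sectionWedge i σ hn ∘ₗ (TensorProduct.mk k _ _).flip y ∘ₗ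
      exteriorPower.map _ π =
      LinearMap.mulRight k (ExteriorAlgebra.map i (y : ExteriorAlgebra k M'')) ∘ₗ
        (⋀[k]^(finrank k M') M).subtype := by
    apply exteriorPower.linearMap_ext
    ext v
    have h := coe_sectionWedge_ιMulti i π hex σ hσ hn v y
    simpa [exteriorPower.map_apply_ιMulti, Function.comp_def] using h
  exact LinearMap.congr_fun e u

end LinearAlgebra

/-- The map induced on exterior algebras by a morphism of finite-dimensional vector spaces. -/
noncomputable def extMap {S T : FGModuleCat.{u} k} (h : S ⟶ T) :
    ExteriorAlgebra k S →ₐ[k] ExteriorAlgebra k T :=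
  ExteriorAlgebra.map h.hom.hom

variable {S T Z : FGModuleCat.{u} k}

lemma extMap_comp (h : S ⟶ T) (g : T ⟶ Z) (x : ExteriorAlgebra k S) :
    extMap (h ≫ g) x = extMap g (extMap h x) :=
  (DFunLike.congr_fun (ExteriorAlgebra.map_comp_map h.hom.hom g.hom.hom) x).symm

lemma extMap_mem (h : S ⟶ T) {n : ℕ} {x : ExteriorAlgebra k S} (hx : x ∈ ⋀[k]^n S) :
    extMap h x ∈ ⋀[k]^n T :=
  ExteriorAlgebra.map_mem_exteriorPower _ hx

/-- Multivectors of top degree, as elements of the determinant line. -/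
noncomputable def toDet (x : ExteriorAlgebra k S) (hx : x ∈ Top k S) : (detObj S).line :=
  (⟨x, hx⟩ : Top k S)

/-- The multivector underlying an element of the determinant line. -/
noncomputable def ofDet (x : (detObj S).line) : ExteriorAlgebra k S := (Top k S).subtype x

lemma ofDet_mem (x : (detObj S).line) : ofDet x ∈ Top k S := Subtype.prop (p := (· ∈ Top k S)) x

lemma ofDet_injective : Function.Injective (ofDet (S := S)) := Subtype.val_injective

lemma ofDet_ne_zero {x : (detObj S).line} (hx : x ≠ 0) : ofDet x ≠ 0 :=
  fun h => hx (ofDet_injective h)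

lemma ofDet_smul (c : k) (x : (detObj S).line) : ofDet (c • x) = c • ofDet x := rfl

@[simp]
lemma ofDet_toDet (x : ExteriorAlgebra k S) (hx : x ∈ Top k S) : ofDet (toDet x hx) = x := rfl

/-- The value of `detSES` on `π u ⊗ y` is `u ∧ i y`, for any multivector `u` of the right degree. -/
lemma detSES_lift (X : ShortComplex (FGModuleCat.{u} k)) (hX : X.ShortExact)
    {u : ExteriorAlgebra k X.X₂} (hu : u ∈ ⋀[k]^(finrank k X.X₃) X.X₂) (y : (detObj X.X₁).line)
    (c : (detObj X.X₃).line) (hc : ofDet c = extMap X.g u) :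
    ofDet (Hom.ap (detSES X hX).hom (tmul c y)) = u * extMap X.f (ofDet y) := by
  have h := coe_sectionWedge_lift X.f.hom.hom X.g.hom.hom (exact_of_shortExact X hX) _
    (exists_section X hX).choose_spec (finrank_of_shortExact X hX) ⟨u, hu⟩ y
  have hc' : c = exteriorPower.map (finrank k X.X₃) X.g.hom.hom ⟨u, hu⟩ :=
    ofDet_injective (hc.trans (coe_map _ X.g.hom.hom ⟨u, hu⟩).symm)
  rw [hc']
  exact h

lemma exists_lift_of_epi (g : S ⟶ T) [Epi g] {n : ℕ} {c : ExteriorAlgebra k T}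
    (hc : c ∈ ⋀[k]^n T) : ∃ u ∈ ⋀[k]^n S, extMap g u = c := by
  have hg : Function.Surjective g.hom.hom :=
    (ModuleCat.epi_iff_surjective _).1
      (inferInstanceAs (Epi ((forget₂ (FGModuleCat.{u} k) (ModuleCat.{u} k)).map g)))
  obtain ⟨u, hu⟩ := exteriorPower.map_surjective (n := n) hg ⟨c, hc⟩
  exact ⟨u, u.2, (coe_map _ g.hom.hom u).symm.trans (congrArg Subtype.val hu)⟩

/-! ### The isomorphisms `χ_h` via multivectors -/

section Chi

variable (h : S ⟶ T)

lemma finrank_eq_image_add_ker :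
    finrank k S =
      finrank k (Abelian.image h : FGModuleCat k) + finrank k (kernel h : FGModuleCat k) :=
  finrank_of_shortExact _ (kerSES_shortExact h)

lemma finrank_eq_coker_add_image :
    finrank k T =
      finrank k (cokernel h : FGModuleCat k) + finrank k (Abelian.image h : FGModuleCat k) :=
  finrank_of_shortExact _ (cokerSES_shortExact h)

lemma finrank_eq_of_iso (e : S ≅ T) : finrank k S = finrank k T :=
  (FGModuleCat.isoToLinearEquiv e).finrank_eq

lemma detCoker_lift {c : ExteriorAlgebra k T}
    (hc : c ∈ ⋀[k]^(finrank k (cokernel h : FGModuleCat k)) T)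
    {i : ExteriorAlgebra k S} (y : (detObj (cokernel h)).line)
    (hy : ofDet y = extMap (cokernel.π h) c) (j : (detObj (Abelian.image h)).line)
    (hj : ofDet j = extMap (Abelian.factorThruImage h) i) :
    ofDet (Hom.ap (detCoker h).hom (tmul y j)) = c * extMap h i := by
  refine (detSES_lift (cokerSES h) (cokerSES_shortExact h) hc j y hy).trans (congrArg (c * ·) ?_)
  change extMap (Abelian.image.ι h) (ofDet j) = _
  rw [hj, ← extMap_comp, Abelian.image.fac]

lemma detKer_lift {i : ExteriorAlgebra k S}
    (hi : i ∈ ⋀[k]^(finrank k (Abelian.image h : FGModuleCat k)) S)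
    (j : (detObj (Abelian.image h)).line)
    (hj : ofDet j = extMap (Abelian.factorThruImage h) i) (f : (detObj (kernel h)).line) :
    ofDet (Hom.ap (detKer h).hom (tmul j f)) = i * extMap (kernel.ι h) (ofDet f) :=
  detSES_lift (kerSES h) (kerSES_shortExact h) hi f j hj

/-- The isomorphism `χ_h` in terms of multivectors: `(c ∧ h i) ⊗ f ↦ π c ⊗ (i ∧ f)` for
multivectors `c` of `T` and `i` of `S` of degrees `dim (Coker h)` and `dim (Im h)`. -/
lemma ap_detChi {c : ExteriorAlgebra k T} (hc : c ∈ ⋀[k]^(finrank k (cokernel h : FGModuleCat k)) T)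
    {i : ExteriorAlgebra k S} (hi : i ∈ ⋀[k]^(finrank k (Abelian.image h : FGModuleCat k)) S)
    (x : (detObj T).line) (hx : ofDet x = c * extMap h i) (f : (detObj (kernel h)).line)
    (y : (detObj (cokernel h)).line) (hy : ofDet y = extMap (cokernel.π h) c)
    (z : (detObj S).line) (hz : ofDet z = i * extMap (kernel.ι h) (ofDet f)) :
    Hom.ap (detChi h).hom (tmul x f) = tmul y z := by
  let j : (detObj (Abelian.image h)).line :=
    toDet (extMap (Abelian.factorThruImage h) i) (extMap_mem _ hi)
  have hxj : x = Hom.ap (detCoker h).hom (tmul y j) :=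
    ofDet_injective (hx.trans (detCoker_lift h hc y hy j rfl).symm)
  have hzj : Hom.ap (detKer h).hom (tmul j f) = z :=
    ofDet_injective ((detKer_lift h hi j rfl f).trans hz.symm)
  have hinv : Hom.ap (detCoker h).inv x = tmul y j := by
    rw [hxj, ← ap_comp, Iso.hom_inv_id]; rfl
  change Hom.ap ((detCoker h).inv ▷ _ ≫ (α_ _ _ _).hom ≫ _ ◁ (detKer h).hom) (tmul x f) = _
  rw [ap_comp, ap_comp, ap_whiskerRight, hinv, ap_associator_hom, ap_whiskerLeft, hzj]

/-- A lift `c` of a generator of `det (Coker h)` is completed to a generator `c ∧ h i` of `det T`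
by a lift `i` of a generator of `det (Im h)`. -/
lemma exists_lift_image (c : ExteriorAlgebra k T)
    (hc : c ∈ ⋀[k]^(finrank k (cokernel h : FGModuleCat k)) T)
    (hc0 : extMap (cokernel.π h) c ≠ 0) :
    ∃ i ∈ ⋀[k]^(finrank k (Abelian.image h : FGModuleCat k)) S, c * extMap h i ≠ 0 := by
  let y : (detObj (cokernel h)).line := toDet _ (extMap_mem (cokernel.π h) hc)
  have hy : y ≠ 0 := fun h0 => hc0 (congrArg ofDet h0)
  obtain ⟨j, hj⟩ := GradedLine.exists_ne_zero (detObj (Abelian.image h))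
  obtain ⟨i, hi, hij⟩ := exists_lift_of_epi (Abelian.factorThruImage h) (ofDet_mem j)
  refine ⟨i, hi, ?_⟩
  have hx := ofDet_ne_zero (ap_hom_ne_zero (detCoker h) (tmul_ne_zero hy hj))
  rwa [detCoker_lift h hc y rfl j hij.symm] at hx

end Chi

/-! ### Naturality -/

/-- The isomorphism of determinant lines induced by an isomorphism of vector spaces. -/
noncomputable def detMap (e : S ≅ T) : detObj S ⟶ detObj T :=
  (detFunctor k).map (X := ⟨S⟩) (Y := ⟨T⟩) ⟨e⟩

lemma ofDet_detMap (e : S ≅ T) (x : (detObj S).line) :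
    ofDet (Hom.ap (detMap e) x) = extMap e.hom (ofDet x) :=
  coe_topMap (FGModuleCat.isoToLinearEquiv e) x

lemma mul_mem_exteriorPower_of_eq {l m n : ℕ} {x y : ExteriorAlgebra k S}
    (hx : x ∈ ⋀[k]^m S) (hy : y ∈ ⋀[k]^n S) (e : l = m + n) : x * y ∈ ⋀[k]^l S :=
  e ▸ ExteriorAlgebra.mul_mem_exteriorPower hx hy

lemma detChi_naturality {S' T' S'' T'' : FGModuleCat.{u} k} (h' : S' ⟶ T') (h'' : S'' ⟶ T'')
    (s : S' ≅ S'') (t : T' ≅ T'') (w : h' ≫ t.hom = s.hom ≫ h'') :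
    (detChi h').hom ≫ (detMap (cokernel.mapIso h' h'' s t w) ⊗ₘ detMap s) =
      (detMap t ⊗ₘ detMap (kernel.mapIso h' h'' s t w)) ≫ (detChi h'').hom := by
  obtain ⟨f, hf⟩ := GradedLine.exists_ne_zero (detObj (kernel h'))
  obtain ⟨y, hy⟩ := GradedLine.exists_ne_zero (detObj (cokernel h'))
  obtain ⟨c, hc, hcy⟩ := exists_lift_of_epi (cokernel.π h') (ofDet_mem y)
  obtain ⟨i, hi, hci⟩ := exists_lift_image h' c hc (by rw [hcy]; exact ofDet_ne_zero hy)
  let x : (detObj T').line := toDet (c * extMap h' i)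
    (mul_mem_exteriorPower_of_eq hc (extMap_mem h' hi) (finrank_eq_coker_add_image h'))
  have hx : x ≠ 0 := fun h0 => hci (congrArg ofDet h0)
  let z : (detObj S').line := toDet (i * extMap (kernel.ι h') (ofDet f))
    (mul_mem_exteriorPower_of_eq hi (extMap_mem _ (ofDet_mem f)) (finrank_eq_image_add_ker h'))
  have hC := finrank_eq_of_iso (cokernel.mapIso h' h'' s t w)
  have hK := finrank_eq_of_iso (kernel.mapIso h' h'' s t w)
  have hI : finrank k (Abelian.image h' : FGModuleCat k) =
      finrank k (Abelian.image h'' : FGModuleCat k) := by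
    have h1 := finrank_eq_image_add_ker h'
    have h2 := finrank_eq_image_add_ker h''
    have h3 := finrank_eq_of_iso s
    omega
  refine hom_eq_of_ap_eq (tmul_ne_zero hx hf) ?_
  rw [ap_comp, ap_comp, ap_detChi h' hc hi x rfl f y hcy.symm z rfl, ap_tensorHom, ap_tensorHom]
  refine (ap_detChi h'' (c := extMap t.hom c) (hC ▸ extMap_mem t.hom hc)
    (i := extMap s.hom i) (hI ▸ extMap_mem s.hom hi) _ ?_ _ _ ?_ _ ?_).symm
  · rw [ofDet_detMap, ofDet_toDet, map_mul, ← extMap_comp, ← extMap_comp, w]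
  · rw [ofDet_detMap, ← hcy, ← extMap_comp, ← extMap_comp]
    simp
  · rw [ofDet_detMap, ofDet_detMap, ofDet_toDet, map_mul, ← extMap_comp, ← extMap_comp]
    simp

/-! ### Coherence -/

section Coherence

variable (h : S ⟶ T) (g : T ⟶ Z)

lemma finrank_image_left :
    finrank k (Abelian.image h : FGModuleCat k) =
      finrank k (Abelian.image (h ≫ g) : FGModuleCat k) +
        finrank k (Abelian.image (fiberMap h g) : FGModuleCat k) := by
  have h1 := finrank_eq_image_add_ker h
  have h2 := finrank_eq_image_add_ker (h ≫ g)
  have h3 := finrank_eq_image_add_ker (fiberMap h g)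
  have h4 := finrank_eq_of_iso (kerFiberMapIso h g)
  omega

lemma finrank_image_right :
    finrank k (Abelian.image g : FGModuleCat k) =
      finrank k (Abelian.image (cofiberMap h g) : FGModuleCat k) +
        finrank k (Abelian.image (h ≫ g) : FGModuleCat k) := by
  have h1 := finrank_eq_coker_add_image g
  have h2 := finrank_eq_coker_add_image (h ≫ g)
  have h3 := finrank_eq_coker_add_image (cofiberMap h g)
  have h4 := finrank_eq_of_iso (cokerCofiberMapIso h g)
  omega

lemma finrank_cokernel_eq :
    finrank k (cokernel h : FGModuleCat k) =
      finrank k (Abelian.image (cofiberMap h g) : FGModuleCat k) +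
        finrank k (cokernel (fiberMap h g) : FGModuleCat k) := by
  rw [finrank_eq_image_add_ker (cofiberMap h g), finrank_eq_of_iso (rhoIso h g)]

lemma finrank_cokernel_comp :
    finrank k (cokernel (h ≫ g) : FGModuleCat k) =
      finrank k (cokernel g : FGModuleCat k) +
        finrank k (Abelian.image (cofiberMap h g) : FGModuleCat k) := by
  rw [finrank_eq_coker_add_image (cofiberMap h g), finrank_eq_of_iso (cokerCofiberMapIso h g)]

/-- The Koszul sign of moving a factor of degree `m` past one of degree `x` and then back past one
of degree `r + x`: the contributions of `x` cancel. -/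
lemma sign_mul_sign_eq (r x m : ℕ) :
    (sign k m x : k) * (sign k (r + x : ℤ) m : k) = (-1) ^ (r * m) := by
  rw [← Units.val_mul, sign_add_left, mul_left_comm, sign_mul_sign, mul_one, sign, ← Nat.cast_mul,
    zpow_natCast]
  simp

lemma detChi_coherence :
    (detChi g).hom ▷ detObj (kernel h) ≫
      (α_ (detObj (cokernel g)) (detObj T) (detObj (kernel h))).hom ≫
      detObj (cokernel g) ◁ (detChi h).hom =
    (α_ (detObj Z) (detObj (kernel g)) (detObj (kernel h))).hom ≫
      detObj Z ◁ (detObj (kernel g) ◁ detMap (kerFiberMapIso h g).symm) ≫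
      detObj Z ◁ (detChi (fiberMap h g)).hom ≫
      detObj Z ◁ (β_ (detObj (cokernel (fiberMap h g))) (detObj (kernel (h ≫ g)))).hom ≫
      (α_ (detObj Z) (detObj (kernel (h ≫ g))) (detObj (cokernel (fiberMap h g)))).inv ≫
      ((detChi (h ≫ g)).hom ⊗ₘ detMap (rhoIso h g)) ≫
      (α_ (detObj (cokernel (h ≫ g))) (detObj S) (detObj (kernel (cofiberMap h g)))).hom ≫
      detObj (cokernel (h ≫ g)) ◁ (β_ (detObj S) (detObj (kernel (cofiberMap h g)))).hom ≫
      (α_ (detObj (cokernel (h ≫ g))) (detObj (kernel (cofiberMap h g))) (detObj S)).inv ≫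
      (detChi (cofiberMap h g)).hom ▷ detObj S ≫
      (detMap (cokerCofiberMapIso h g) ▷ detObj (cokernel h)) ▷ detObj S ≫
      (α_ (detObj (cokernel g)) (detObj (cokernel h)) (detObj S)).hom := by
  obtain ⟨f, hf⟩ := GradedLine.exists_ne_zero (detObj (kernel h))
  obtain ⟨m, hm⟩ := GradedLine.exists_ne_zero (detObj (cokernel (fiberMap h g)))
  obtain ⟨d, hd⟩ := GradedLine.exists_ne_zero (detObj (cokernel g))
  -- Multivectors lifting generators of the determinants of `Coker h_Z`, `Im h_Z`, `Coker g`,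
  -- `Im g^S` and `Im (g ∘ h)`; every other space is filtered by these and by `Ker h`.
  obtain ⟨b, hb, hbm⟩ := exists_lift_of_epi (cokernel.π (fiberMap h g)) (ofDet_mem m)
  obtain ⟨a, ha, hba⟩ := exists_lift_image (fiberMap h g) b hb
    (by rw [hbm]; exact ofDet_ne_zero hm)
  obtain ⟨e, he, hed⟩ := exists_lift_of_epi (cokernel.π g) (ofDet_mem d)
  have hπ : cokernel.π (h ≫ g) ≫ cokernel.π (cofiberMap h g) ≫ (cokerCofiberMapIso h g).hom =
      cokernel.π g := by simp [cokerCofiberMapIso]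
  have he' : e ∈ ⋀[k]^(finrank k (cokernel (cofiberMap h g) : FGModuleCat k)) Z := by
    rwa [finrank_eq_of_iso (cokerCofiberMapIso h g)]
  obtain ⟨τ, hτ, heτ⟩ := exists_lift_image (cofiberMap h g) (extMap (cokernel.π (h ≫ g)) e)
    (extMap_mem _ he') (fun h0 => ofDet_ne_zero hd (by
      rw [← hed, ← hπ, extMap_comp, extMap_comp, h0, map_zero]))
  obtain ⟨t, ht, rfl⟩ := exists_lift_of_epi (cokernel.π h) hτ
  have hegt : e * extMap g t ∈ ⋀[k]^(finrank k (cokernel (h ≫ g) : FGModuleCat k)) Z :=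
    mul_mem_exteriorPower_of_eq he (extMap_mem g ht) (finrank_cokernel_comp h g)
  have hπegt : extMap (cokernel.π (h ≫ g)) (e * extMap g t) =
      extMap (cokernel.π (h ≫ g)) e * extMap (cofiberMap h g) (extMap (cokernel.π h) t) := by
    rw [map_mul, ← extMap_comp, ← extMap_comp, π_cofiberMap]
  obtain ⟨i, hi, hegti⟩ := exists_lift_image (h ≫ g) _ hegt (by rwa [hπegt])
  let z : (detObj Z).line := toDet (e * extMap g t * extMap (h ≫ g) i)
    (mul_mem_exteriorPower_of_eq hegt (extMap_mem _ hi) (finrank_eq_coker_add_image (h ≫ g)))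
  have hz : z ≠ 0 := fun h0 => hegti (congrArg ofDet h0)
  let y : (detObj (kernel g)).line := toDet (b * extMap (fiberMap h g) a)
    (mul_mem_exteriorPower_of_eq hb (extMap_mem _ ha) (finrank_eq_coker_add_image (fiberMap h g)))
  have hy : y ≠ 0 := fun h0 => hba (congrArg ofDet h0)
  -- The element `i ∧ a ∧ f` of `det S`.
  have hia : i * extMap (kernel.ι (h ≫ g)) a ∈
      ⋀[k]^(finrank k (Abelian.image h : FGModuleCat k)) S :=
    mul_mem_exteriorPower_of_eq hi (extMap_mem _ ha) (finrank_image_left h g)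
  let s : (detObj S).line := toDet (i * extMap (kernel.ι (h ≫ g)) a * extMap (kernel.ι h) (ofDet f))
    (mul_mem_exteriorPower_of_eq hia (extMap_mem _ (ofDet_mem f)) (finrank_eq_image_add_ker h))
  -- The element `t ∧ b` of `det (Coker h)`.
  have htb : t * extMap (kernel.ι g) b ∈ ⋀[k]^(finrank k (cokernel h : FGModuleCat k)) T :=
    mul_mem_exteriorPower_of_eq ht (extMap_mem _ hb) (finrank_cokernel_eq h g)
  let c : (detObj (cokernel h)).line := toDet _ (extMap_mem (cokernel.π h) htb)
  -- The left-hand side: the sign `ε` arises where `h i` is moved past `b`.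
  have hti : t * extMap h i ∈ ⋀[k]^(finrank k (Abelian.image g : FGModuleCat k)) T :=
    mul_mem_exteriorPower_of_eq ht (extMap_mem h hi) (finrank_image_right h g)
  let ε : k := (-1) ^ (finrank k (Abelian.image (h ≫ g) : FGModuleCat k) *
    finrank k (cokernel (fiberMap h g) : FGModuleCat k))
  let x : (detObj T).line := toDet (t * extMap (kernel.ι g) b *
      extMap h (i * extMap (kernel.ι (h ≫ g)) a))
    (mul_mem_exteriorPower_of_eq htb (extMap_mem _ hia) (finrank_eq_coker_add_image h))
  have hχg : Hom.ap (detChi g).hom (tmul z y) = tmul d (ε • x) := by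
    refine ap_detChi g he hti z ?_ y d hed.symm _ ?_
    · rw [ofDet_toDet, map_mul, ← extMap_comp, mul_assoc]
    · rw [ofDet_smul, ofDet_toDet, ofDet_toDet, map_mul, map_mul, ← extMap_comp, ← extMap_comp,
        fiberMap_ι, mul_assoc, mul_assoc, ← mul_assoc (extMap h i),
        ExteriorAlgebra.mul_eq_pow_smul_mul (extMap_mem h hi) (extMap_mem (kernel.ι g) hb),
        smul_mul_assoc, mul_smul_comm, mul_assoc]
  have hχh : Hom.ap (detChi h).hom (tmul x f) = tmul c s :=
    ap_detChi h htb hia x rfl f c rfl s rfl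
  -- The right-hand side: `f` is first transported to `Ker h_Z`.
  let f' := Hom.ap (detMap (kerFiberMapIso h g).symm) f
  have hf' : extMap (kernel.ι (fiberMap h g) ≫ kernel.ι (h ≫ g)) (ofDet f') =
      extMap (kernel.ι h) (ofDet f) := by
    rw [ofDet_detMap, ← extMap_comp]
    simp [kerFiberMapIso]
  let q : (detObj (kernel (h ≫ g))).line := toDet (a * extMap (kernel.ι (fiberMap h g)) (ofDet f'))
    (mul_mem_exteriorPower_of_eq ha (extMap_mem _ (ofDet_mem f'))
      (finrank_eq_image_add_ker (fiberMap h g)))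
  have hχf : Hom.ap (detChi (fiberMap h g)).hom (tmul y f') = tmul m q :=
    ap_detChi (fiberMap h g) hb ha y rfl f' m hbm.symm q rfl
  let r : (detObj (cokernel (h ≫ g))).line := toDet _ (extMap_mem (cokernel.π (h ≫ g)) hegt)
  have hχgh : Hom.ap (detChi (h ≫ g)).hom (tmul z q) = tmul r s := by
    refine ap_detChi (h ≫ g) hegt hi z rfl q r rfl s ?_
    rw [ofDet_toDet, ofDet_toDet, map_mul, ← extMap_comp, hf', mul_assoc]
  -- The element `d` of `det (Coker g)`, seen in `det (Coker g^S)`.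
  let d' : (detObj (cokernel (cofiberMap h g))).line :=
    toDet _ (extMap_mem (cokernel.π (cofiberMap h g)) (extMap_mem (cokernel.π (h ≫ g)) he'))
  have hd' : Hom.ap (detMap (cokerCofiberMapIso h g)) d' = d := by
    apply ofDet_injective
    rw [ofDet_detMap, ofDet_toDet, ← extMap_comp, ← extMap_comp, hπ, hed]
  have hχc : Hom.ap (detChi (cofiberMap h g)).hom (tmul r (Hom.ap (detMap (rhoIso h g)) m)) =
      tmul d' c := by
    refine ap_detChi (cofiberMap h g) (extMap_mem _ he') hτ r hπegt _ d' rfl c ?_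
    rw [ofDet_detMap, ← hbm, ofDet_toDet, map_mul, ← extMap_comp, ← extMap_comp, ← extMap_comp,
      ← π_rho_ι]
    simp [rhoIso]
  -- The two symmetries on the right-hand side contribute the sign `ε`.
  have hε : (sign k (detObj (cokernel (fiberMap h g))).deg (detObj (kernel (h ≫ g))).deg : k) *
      (sign k (detObj S).deg (detObj (kernel (cofiberMap h g))).deg : k) = ε := by
    rw [detObj_deg, detObj_deg, detObj_deg, detObj_deg, ← finrank_eq_of_iso (rhoIso h g),
      finrank_eq_image_add_ker (h ≫ g), Nat.cast_add, sign_mul_sign_eq]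
  refine hom_eq_of_ap_eq (tmul_ne_zero (tmul_ne_zero hz hy) hf) ?_
  simp only [ap_comp, ap_whiskerRight, ap_whiskerLeft, ap_associator_hom, ap_smul, smul_tmul,
    tmul_smul, hχg, hχh]
  rw [hχf]
  simp only [ap_whiskerRight, ap_whiskerLeft, ap_associator_hom, ap_associator_inv,
    ap_tensorHom, ap_braiding, ap_smul, tmul_smul, hχgh, hχc, hd', smul_smul]
  rw [hε]

end Coherence

end Determinant

theorem mainTheorem3 (k : Type u) [Field k] :
    IsBicharade (Determinant.detFunctor k) (fun h => (Determinant.detChi h).hom) where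
  naturality h' h'' s t w := Determinant.detChi_naturality h' h'' s t w
  coherence h g := Determinant.detChi_coherence h g
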